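/- All graphs are finite and simple. Let $G$ be a graph whose vertices are assigned integer ranks. A path in $G$ is \emph{well-ranked} if its two endpoints have distinct ranks, or some interior vertex of the path has a higher rank than both endpoints. A \emph{$2$-ranking} of $G$ is an assignment of integer ranks to the vertices such that every path of length $1$ or $2$ is well-ranked, and $\chi_2(G)$ denotes the minimum $t$ such that $G$ has a $2$-ranking using only ranks in $\{1,\ldots,t\}$. \textbf{Theorem.} If $G$ is subcubic, that is, $G$ has maximum degree at most $3$, then $\chi_2(G)\le 7$. -/

import Mathlib

namespace SimpleGraph

variable {V : Type*}

/-- A path `p` from `u` to `v` in a graph whose vertices carry integer ranks `r` is well-ranked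
if its endpoints have distinct ranks, or some interior vertex has a rank higher than the ranks of
both endpoints. (The interior vertices of a path are its vertices other than the endpoints.) -/
def IsWellRanked (G : SimpleGraph V) (r : V → ℤ) {u v : V} (p : G.Walk u v) : Prop :=
  r u ≠ r v ∨ ∃ w ∈ p.support, w ≠ u ∧ w ≠ v ∧ r u < r w ∧ r v < r w

/-- `r` is a `k`-ranking of `G`: every path of positive length at most `k` is well-ranked. -/
def IsKRanking (G : SimpleGraph V) (k : ℕ) (r : V → ℤ) : Prop :=
  ∀ (u v : V) (p : G.Walk u v), p.IsPath → 0 < p.length → p.length ≤ k → G.IsWellRanked r p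

/-- The `k`-ranking number of `G`: the least `t` such that `G` has a `k`-ranking with all ranks
in `{1, …, t}` (and `⊤` if there is no such `t`, which cannot happen for a finite graph). -/
noncomputable def kRankingNumber (G : SimpleGraph V) (k : ℕ) : ℕ∞ :=
  ⨅ t ∈ {t : ℕ | ∃ r : V → ℤ, G.IsKRanking k r ∧ ∀ v, r v ∈ Set.Icc (1 : ℤ) t}, (t : ℕ∞)

/-- A finite graph is subcubic if its maximum degree is at most `3`. -/
def IsSubcubic (G : SimpleGraph V) [Fintype V] [DecidableRel G.Adj] : Prop :=
  G.maxDegree ≤ 3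

end SimpleGraph

/-! Give rank 1 to an independent dominating set `I`; two of its vertices at distance two have only
higher-ranked common neighbors. It remains to color the other vertices with six ranks, distinct
within distance two. Each neighbor of `x ∉ I` accounts for at most two conflicts, so `x` has at most
six. Greedy coloring needs only one vertex per component with at most five, since the saving
propagates (`exists_card_conflicts_inter_le`). If a given `I` offers no such vertex, its conflict
sets are rigid, and forcing a suitable vertex into `I` creates one
(`exists_isIndepDominating_card_conflicts_le`). -/

namespace SimpleGraph

variable {V : Type*}

/-- `I` is an independent set of `G` that dominates all other vertices. -/
def IsIndepDominating (G : SimpleGraph V) (I : Set V) : Prop :=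
  (∀ x ∈ I, ∀ y ∈ I, ¬ G.Adj x y) ∧ ∀ x ∉ I, ∃ z ∈ I, G.Adj x z

theorem exists_isIndepDominating_superset [Finite V] (G : SimpleGraph V) {J : Set V}
    (hJ : ∀ x ∈ J, ∀ y ∈ J, ¬ G.Adj x y) : ∃ I, J ⊆ I ∧ G.IsIndepDominating I := by
  obtain ⟨I, hJI, hI⟩ := (Set.toFinite {K : Set V | ∀ x ∈ K, ∀ y ∈ K, ¬ G.Adj x y}).exists_le_maximal
    (a := J) hJ
  refine ⟨I, hJI, hI.prop, fun x hx => ?_⟩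
  by_contra! hcon
  refine hx (hI.le_of_ge (y := insert x I) ?_ (Set.subset_insert x I) (Set.mem_insert x I))
  rintro a (rfl | ha) b (rfl | hb) hab
  · exact G.loopless.irrefl _ hab
  · exact hcon b hb hab
  · exact hcon a ha hab.symm
  · exact hI.prop a ha b hb hab

/-! ### Counting conflicts and choosing `I` -/

section Conflicts

variable [Fintype V]

open Classical in
/-- The vertices outside `I`, other than `x`, in the closed neighborhood of `z`. -/
noncomputable def conflictsVia (G : SimpleGraph V) (I : Set V) (x z : V) : Finset V :=
  {y | y ∉ I ∧ y ≠ x ∧ (y = z ∨ G.Adj z y)}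

open Classical in
/-- The vertices outside `I`, other than `x`, at distance at most `2` from `x`. -/
noncomputable def conflicts (G : SimpleGraph V) (I : Set V) (x : V) : Finset V :=
  {y | y ∉ I ∧ y ≠ x ∧ ∃ z, G.Adj x z ∧ (y = z ∨ G.Adj z y)}

variable {G : SimpleGraph V} {I : Set V} {x y z : V}

theorem mem_conflictsVia :
    y ∈ G.conflictsVia I x z ↔ y ∉ I ∧ y ≠ x ∧ (y = z ∨ G.Adj z y) := by
  simp [conflictsVia]

theorem mem_conflicts :
    y ∈ G.conflicts I x ↔ y ∉ I ∧ y ≠ x ∧ ∃ z, G.Adj x z ∧ (y = z ∨ G.Adj z y) := by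
  simp [conflicts]

theorem mem_conflicts_comm (hx : x ∉ I) (h : y ∈ G.conflicts I x) : x ∈ G.conflicts I y := by
  obtain ⟨-, hyx, z, hxz, rfl | hzy⟩ := mem_conflicts.1 h
  · exact mem_conflicts.2 ⟨hx, hyx.symm, x, hxz.symm, .inl rfl⟩
  · exact mem_conflicts.2 ⟨hx, hyx.symm, z, hzy.symm, .inr hxz.symm⟩

variable [DecidableRel G.Adj]

/-- The closed neighborhood of `z` has at most four vertices; `x` is excluded, and so is a vertex of
`I`, present by domination. -/
theorem card_conflictsVia_le (hG : G.IsSubcubic) (hI : G.IsIndepDominating I) (hx : x ∉ I)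
    (hxz : G.Adj x z) : (G.conflictsVia I x z).card ≤ 2 := by
  classical
  have hdeg : (G.neighborFinset z).card ≤ 3 := (G.degree_le_maxDegree z).trans hG
  have hcard : (insert z (G.neighborFinset z)).card ≤ 4 :=
    (Finset.card_insert_le _ _).trans (by omega)
  obtain ⟨w, hwI, hw⟩ : ∃ w ∈ I, w ∈ insert z (G.neighborFinset z) := by
    by_cases hz : z ∈ I
    · exact ⟨z, hz, by simp⟩
    · obtain ⟨w, hw, hzw⟩ := hI.2 z hz
      exact ⟨w, hw, by simp [hzw]⟩
  have hwx : w ≠ x := fun h => hx (h ▸ hwI)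
  have hsub : G.conflictsVia I x z ⊆ ((insert z (G.neighborFinset z)).erase x).erase w := by
    intro y hy
    obtain ⟨hyI, hyx, hyz⟩ := mem_conflictsVia.1 hy
    have hyw : y ≠ w := fun h => hyI (h ▸ hwI)
    simpa [hyx, hyw] using hyz
  have h := Finset.card_le_card hsub
  rw [Finset.card_erase_of_mem (by simpa [hwx] using hw),
    Finset.card_erase_of_mem (by simp [hxz.symm])] at h
  omega

theorem card_conflicts_le_six (hG : G.IsSubcubic) (hI : G.IsIndepDominating I) (hx : x ∉ I) :
    (G.conflicts I x).card ≤ 6 := by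
  classical
  have hsub : G.conflicts I x ⊆ (G.neighborFinset x).biUnion (G.conflictsVia I x) := by
    intro y hy
    obtain ⟨hyI, hyx, z, hxz, hyz⟩ := mem_conflicts.1 hy
    exact Finset.mem_biUnion.2 ⟨z, by simpa using hxz, mem_conflictsVia.2 ⟨hyI, hyx, hyz⟩⟩
  have hdeg : (G.neighborFinset x).card ≤ 3 := (G.degree_le_maxDegree x).trans hG
  have h := Finset.card_biUnion_le_card_mul (G.neighborFinset x) (G.conflictsVia I x) 2
    fun z hz => card_conflictsVia_le hG hI hx (by simpa using hz)
  have h' := Finset.card_le_card hsub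
  omega

/-- If all but one of the conflicts through a neighbor `z` of `x` also arise through other
neighbors, then `x` has at most five conflicts. -/
theorem card_conflicts_le_five (hG : G.IsSubcubic) (hI : G.IsIndepDominating I) (hx : x ∉ I)
    (hxz : G.Adj x z) (a : V) (h : ∀ y ∈ G.conflictsVia I x z,
      y = a ∨ ∃ z', G.Adj x z' ∧ z' ≠ z ∧ y ∈ G.conflictsVia I x z') :
    (G.conflicts I x).card ≤ 5 := by
  classical
  have hsub : G.conflicts I x ⊆
      insert a (((G.neighborFinset x).erase z).biUnion (G.conflictsVia I x)) := by
    intro y hy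
    obtain ⟨hyI, hyx, w, hxw, hyw⟩ := mem_conflicts.1 hy
    have hyw' := mem_conflictsVia.2 ⟨hyI, hyx, hyw⟩
    by_cases hwz : w = z
    · subst hwz
      obtain rfl | ⟨z', hxz', hz', hy'⟩ := h y hyw'
      · simp
      · exact Finset.mem_insert_of_mem (Finset.mem_biUnion.2 ⟨z', by simp [hz', hxz'], hy'⟩)
    · exact Finset.mem_insert_of_mem (Finset.mem_biUnion.2 ⟨w, by simp [hwz, hxw], hyw'⟩)
  have hdeg : (G.neighborFinset x).card ≤ 3 := (G.degree_le_maxDegree x).trans hG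
  have hcard := Finset.card_erase_of_mem (s := G.neighborFinset x) (a := z) (by simpa using hxz)
  have h1 := Finset.card_biUnion_le_card_mul ((G.neighborFinset x).erase z) (G.conflictsVia I x) 2
    fun z hz => card_conflictsVia_le hG hI hx (by simpa using Finset.mem_of_mem_erase hz)
  have h2 := Finset.card_le_card hsub
  have h3 := Finset.card_insert_le a
    (((G.neighborFinset x).erase z).biUnion (G.conflictsVia I x))
  omega

theorem exists_mem_conflictsVia_ne (hG : G.IsSubcubic) (hI : G.IsIndepDominating I) (hx : x ∉ I)
    (h6 : 5 < (G.conflicts I x).card) (hxz : G.Adj x z) (a : V) :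
    ∃ y ∈ G.conflictsVia I x z, y ≠ a := by
  by_contra! h
  exact absurd (card_conflicts_le_five hG hI hx hxz a fun y hy => .inl (h y hy)) (by omega)

/-- Six conflicts need three disjoint contributions of two, so no conflict is shared. -/
theorem eq_of_mem_conflictsVia (hG : G.IsSubcubic) (hI : G.IsIndepDominating I) (hx : x ∉ I)
    (h6 : 5 < (G.conflicts I x).card) {z' : V} (hxz : G.Adj x z) (hxz' : G.Adj x z')
    (hy : y ∈ G.conflictsVia I x z) (hy' : y ∈ G.conflictsVia I x z') : z = z' := by
  classical
  by_contra hne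
  have hcard : ((G.conflictsVia I x z).erase y).card ≤ 1 := by
    rw [Finset.card_erase_of_mem hy]
    have := card_conflictsVia_le hG hI hx hxz
    omega
  have : Nonempty V := ⟨x⟩
  obtain ⟨a, ha⟩ := Finset.card_le_one_iff_subset_singleton.1 hcard
  refine absurd (card_conflicts_le_five hG hI hx hxz a fun w hw => ?_) (not_le.2 h6)
  by_cases hwy : w = y
  · exact .inr ⟨z', hxz', fun h => hne h.symm, hwy ▸ hy'⟩
  · exact .inl (Finset.mem_singleton.1 (ha (Finset.mem_erase.2 ⟨hwy, hw⟩)))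

/-- If every vertex outside `I` in a component has six conflicts, then some other independent
dominating set leaves a vertex of the component with at most five conflicts. -/
theorem exists_isIndepDominating_card_conflicts_le (hG : G.IsSubcubic) (c : G.ConnectedComponent) :
    ∃ I, G.IsIndepDominating I ∧
      ((∀ x ∈ c.supp, x ∈ I) ∨ ∃ x ∈ c.supp, x ∉ I ∧ (G.conflicts I x).card ≤ 5) := by
  obtain ⟨I, -, hI⟩ := G.exists_isIndepDominating_superset (J := ∅) (by simp)
  by_contra! hcon
  obtain ⟨⟨p, hpc, hpI⟩, h6⟩ := hcon I hI
  have hc : ∀ {a b : V}, G.Adj a b → a ∈ c.supp → b ∈ c.supp := fun hab ha =>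
    (c.mem_supp_congr_adj hab).1 ha
  have hindep : ∀ p, ∀ x ∈ insert p (I \ G.neighborSet p), ∀ y ∈ insert p (I \ G.neighborSet p),
      ¬ G.Adj x y := by
    rintro p x (rfl | ⟨hx, hpx⟩) y (rfl | ⟨hy, hpy⟩) hxy
    · exact G.loopless.irrefl _ hxy
    · exact hpy hxy
    · exact hpx hxy.symm
    · exact hI.1 x hx y hy hxy
  have hshared : ∀ {a z z' y : V}, a ∈ c.supp → a ∉ I → G.Adj a z → G.Adj a z' → y ∉ I → y ≠ a →
      (y = z ∨ G.Adj z y) → (y = z' ∨ G.Adj z' y) → z = z' :=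
    fun ha haI hz hz' hyI hya h h' => eq_of_mem_conflictsVia hG hI haI (h6 _ ha haI) hz hz'
      (mem_conflictsVia.2 ⟨hyI, hya, h⟩) (mem_conflictsVia.2 ⟨hyI, hya, h'⟩)
  by_cases hedge : ∃ a ∈ c.supp, ∃ b, a ∉ I ∧ b ∉ I ∧ G.Adj a b
  · obtain ⟨a, hac, b, haI, hbI, hab⟩ := hedge
    obtain ⟨d, hd, hdb⟩ := exists_mem_conflictsVia_ne hG hI haI (h6 a hac haI) hab b
    obtain ⟨hdI, hda, hd⟩ := mem_conflictsVia.1 hd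
    have hbd : G.Adj b d := hd.resolve_left hdb
    obtain ⟨I', hsub, hI'⟩ := G.exists_isIndepDominating_superset (hindep a)
    have haI' : a ∈ I' := hsub (Set.mem_insert _ _)
    -- Such an `m` is not adjacent to `a`: otherwise `a` would reach `y` through both `b` and `m`.
    have hmem : ∀ {m y : V}, m ∈ I → y ∉ I → y ≠ a → (y = b ∨ G.Adj b y) → G.Adj y m → m ∈ I' := by
      intro m y hm hy hya hby hym
      refine hsub (.inr ⟨hm, fun ham => hbI ?_⟩)
      rwa [hshared hac haI hab ham hy hya hby (.inr hym.symm)]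
    have hdI' : d ∉ I' := by
      intro hd'
      obtain ⟨m, hm, hdm⟩ := hI.2 d hdI
      exact hI'.1 d hd' m (hmem hm hdI hda (.inr hbd) hdm) hdm
    -- Through `b`, the vertex `d` now conflicts only with `b`: `a` is in `I'`, and a third neighbor
    -- of `b` lies in `I` and stays in `I'`.
    refine absurd (card_conflicts_le_five hG hI' hdI' hbd.symm b fun y hy => .inl ?_)
      (not_le.2 ((hcon I' hI').2 d (hc hbd (hc hab hac)) hdI'))
    obtain ⟨hyI', hyd, rfl | hby⟩ := mem_conflictsVia.1 hy
    · rfl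
    exfalso
    have hya : y ≠ a := fun h => hyI' (h ▸ haI')
    by_cases hyI : y ∈ I
    · exact hyI' (hmem hyI hbI hab.ne' (.inl rfl) hby)
    · have hcard := card_conflictsVia_le hG hI haI hab
      have : 2 < (G.conflictsVia I a b).card := Finset.two_lt_card.2
        ⟨b, mem_conflictsVia.2 ⟨hbI, hab.ne', .inl rfl⟩, d, mem_conflictsVia.2 ⟨hdI, hda, .inr hbd⟩,
          y, mem_conflictsVia.2 ⟨hyI, hya, .inr hby⟩, hdb.symm, hby.ne, hyd.symm⟩
      omega
  · push Not at hedge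
    obtain ⟨m, hm, hpm⟩ := hI.2 p hpI
    obtain ⟨a, ha, -⟩ := exists_mem_conflictsVia_ne hG hI hpI (h6 p hpc hpI) hpm p
    obtain ⟨haI, hap, ha⟩ := mem_conflictsVia.1 ha
    have hma : G.Adj m a := ha.resolve_left fun h => haI (h ▸ hm)
    obtain ⟨I', hsub, hI'⟩ := G.exists_isIndepDominating_superset (hindep p)
    have hmI' : m ∉ I' := fun h => hI'.1 p (hsub (Set.mem_insert _ _)) m h hpm
    -- All neighbors of `a` lie in `I`, and those other than `m` stay in `I'`, so through `a` the
    -- vertex `m` conflicts only with `a`.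
    refine absurd (card_conflicts_le_five hG hI' hmI' hma a fun y hy => .inl ?_)
      (not_le.2 ((hcon I' hI').2 m (hc hpm hpc) hmI'))
    obtain ⟨hyI', hym, rfl | hay⟩ := mem_conflictsVia.1 hy
    · rfl
    exfalso
    by_cases hyI : y ∈ I
    · refine hyI' (hsub (.inr ⟨hyI, fun hpy => hym ?_⟩))
      exact hshared hpc hpI hpy hpm haI hap (.inr hay.symm) (.inr hma)
    · exact hedge a (hc hma (hc hpm hpc)) y haI hyI hay

end Conflicts

/-! ### Greedy coloring and assembly of the ranking -/

/-- Greedy coloring of a finite set with a symmetric irreflexive conflict relation in which every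
nonempty subset has an element with at most `k` conflicts in the subset. -/
theorem exists_greedy_coloring [DecidableEq V] (D : V → Finset V) (k : ℕ) (S : Finset V)
    (hirrefl : ∀ x, x ∉ D x) (hsymm : ∀ x ∈ S, ∀ y ∈ S, y ∈ D x → x ∈ D y)
    (h : ∀ T ⊆ S, T.Nonempty → ∃ x ∈ T, (D x ∩ T).card ≤ k) :
    ∃ f : V → Fin (k + 1), ∀ x ∈ S, ∀ y ∈ S, y ∈ D x → f x ≠ f y := by
  induction S using Finset.strongInduction with
  | H S ih =>
    obtain rfl | hS := S.eq_empty_or_nonempty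
    · exact ⟨fun _ => 0, by simp⟩
    obtain ⟨x, hx, hcard⟩ := h S subset_rfl hS
    have hsub := Finset.erase_subset x S
    obtain ⟨f, hf⟩ := ih (S.erase x) (Finset.erase_ssubset hx)
      (fun a ha b hb => hsymm a (hsub ha) b (hsub hb)) fun T hT => h T (hT.trans hsub)
    obtain ⟨i, hi⟩ : ∃ i, i ∉ (D x ∩ S).image f := by
      by_contra! hall
      have h1 : Finset.univ ⊆ (D x ∩ S).image f := fun i _ => hall i
      have h2 := Finset.card_le_card h1
      have h3 := Finset.card_image_le (s := D x ∩ S) (f := f)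
      rw [Finset.card_univ, Fintype.card_fin] at h2
      omega
    have hi' : ∀ y ∈ S, y ∈ D x → f y ≠ i := fun y hy hyx heq =>
      hi (Finset.mem_image.2 ⟨y, Finset.mem_inter.2 ⟨hyx, hy⟩, heq⟩)
    refine ⟨Function.update f x i, fun a ha b hb hab => ?_⟩
    by_cases hax : a = x
    · subst hax
      have hba : b ≠ a := fun h => hirrefl a (h ▸ hab)
      rw [Function.update_self, Function.update_of_ne hba]
      exact (hi' b hb hab).symm
    · by_cases hbx : b = x
      · subst hbx
        rw [Function.update_self, Function.update_of_ne hax]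
        exact hi' a ha (hsymm a ha b hb hab)
      · rw [Function.update_of_ne hax, Function.update_of_ne hbx]
        exact hf a (by simp [hax, ha]) b (by simp [hbx, hb]) hab

variable {G : SimpleGraph V}

/-- In a component with a vertex that has at most five conflicts, every nonempty set of vertices
outside `I` contains a vertex with at most five conflicts in the set. -/
theorem exists_card_conflicts_inter_le [Fintype V] [DecidableEq V] [DecidableRel G.Adj]
    (hG : G.IsSubcubic) {I : Set V} (hI : G.IsIndepDominating I) {c : G.ConnectedComponent} {w : V}
    (hwc : w ∈ c.supp) (hwI : w ∉ I) (hw : (G.conflicts I w).card ≤ 5) {T : Finset V}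
    (hT : ∀ x ∈ T, x ∈ c.supp ∧ x ∉ I) (hne : T.Nonempty) :
    ∃ x ∈ T, (G.conflicts I x ∩ T).card ≤ 5 := by
  by_contra! hcon
  -- Six is the maximum, so `T` contains every conflict of its members.
  have hsub : ∀ x ∈ T, G.conflicts I x ⊆ T := fun x hx => by
    have h6 := card_conflicts_le_six hG hI (hT x hx).2
    have := Finset.eq_of_subset_of_card_le (Finset.inter_subset_left (s₂ := T))
      (h6.trans (hcon x hx))
    exact Finset.inter_eq_left.1 this
  -- A walk leaving `T` can only step into `I`; as `I` is independent, its next vertex is `t` or a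
  -- conflict of `t`, hence back in `T`.
  have hwalk : ∀ {u v : V} (_ : G.Walk u v), (u ∈ T ∨ u ∈ I ∧ ∃ t ∈ T, G.Adj t u) →
      (v ∈ T ∨ v ∈ I ∧ ∃ t ∈ T, G.Adj t v) := by
    intro u v q
    induction q with
    | nil => exact id
    | @cons a b _ hab _ ih =>
      refine fun ha => ih ?_
      obtain ha | ⟨haI, t, ht, hta⟩ := ha
      · by_cases hb : b ∈ I
        · exact .inr ⟨hb, a, ha, hab⟩
        · exact .inl (hsub a ha (mem_conflicts.2 ⟨hb, hab.ne', b, hab, .inl rfl⟩))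
      · by_cases hbt : b = t
        · exact .inl (hbt ▸ ht)
        · exact .inl (hsub t ht (mem_conflicts.2
            ⟨fun hb => hI.1 a haI b hb hab, hbt, a, hta, .inr hab⟩))
  obtain ⟨t, ht⟩ := hne
  obtain ⟨q⟩ := ConnectedComponent.exact ((hT t ht).1.trans hwc.symm)
  have hwT : w ∈ T := (hwalk q (.inl ht)).resolve_right fun h => hwI h.1
  have := Finset.card_le_card (Finset.inter_subset_left (s₁ := G.conflicts I w) (s₂ := T))
  have := hcon w hwT
  omega

theorem exists_component_ranking [Fintype V] [DecidableRel G.Adj] (hG : G.IsSubcubic)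
    (c : G.ConnectedComponent) : ∃ r : V → ℤ, (∀ v, r v ∈ Set.Icc (1 : ℤ) 7) ∧
      (∀ u ∈ c.supp, ∀ v, G.Adj u v → r u ≠ r v) ∧
      ∀ u ∈ c.supp, ∀ v w, G.Adj u v → G.Adj v w → u ≠ w → r u = r w → r u < r v := by
  classical
  obtain ⟨I, hI, hor⟩ := exists_isIndepDominating_card_conflicts_le hG c
  have hc : ∀ {a b : V}, G.Adj a b → a ∈ c.supp → b ∈ c.supp := fun hab ha =>
    (c.mem_supp_congr_adj hab).1 ha
  obtain ⟨f, hf⟩ := exists_greedy_coloring (G.conflicts I) 5 ({x | x ∈ c.supp ∧ x ∉ I} : Finset V)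
    (fun x hx => (mem_conflicts.1 hx).2.1 rfl)
    (fun x hx y _ h => mem_conflicts_comm (by simp at hx; exact hx.2) h) (by
      intro T hT hne
      have hT' : ∀ x ∈ T, x ∈ c.supp ∧ x ∉ I := fun x hx => by simpa using hT hx
      obtain hall | ⟨w, hwc, hwI, hw⟩ := hor
      · obtain ⟨t, ht⟩ := hne
        exact absurd (hall t (hT' t ht).1) (hT' t ht).2
      · exact exists_card_conflicts_inter_le hG hI hwc hwI hw hT' hne)
  have hf' : ∀ x ∈ c.supp, ∀ y ∈ c.supp, x ∉ I → y ∈ G.conflicts I x → f x ≠ f y :=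
    fun x hx y hy hxI hyx => hf x (by simpa using ⟨hx, hxI⟩) y
      (by simpa using ⟨hy, (mem_conflicts.1 hyx).1⟩) hyx
  let r : V → ℤ := fun v => if v ∈ I then 1 else ((f v : ℕ) : ℤ) + 2
  have hrI : ∀ v ∈ I, r v = 1 := fun v hv => if_pos hv
  have hrF : ∀ v ∉ I, r v = ((f v : ℕ) : ℤ) + 2 := fun v hv => if_neg hv
  have hne : ∀ u ∈ c.supp, ∀ v ∈ c.supp, u ∉ I → (v ∉ I → v ∈ G.conflicts I u) → r u ≠ r v := by
    intro u hu v hv huI hvu heq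
    by_cases hvI : v ∈ I
    · rw [hrI v hvI, hrF u huI] at heq
      omega
    · rw [hrF v hvI, hrF u huI] at heq
      exact hf' u hu v hv huI (hvu hvI) (Fin.ext (by omega))
  have hadj : ∀ u ∈ c.supp, ∀ v ∈ c.supp, G.Adj u v → u ∉ I → r u ≠ r v :=
    fun u hu v hv huv huI => hne u hu v hv huI fun hvI =>
      mem_conflicts.2 ⟨hvI, huv.ne', v, huv, .inl rfl⟩
  refine ⟨r, fun v => ?_, fun u hu v huv => ?_, fun u hu v w huv hvw huw heq => ?_⟩
  · by_cases hv : v ∈ I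
    · simp [hrI v hv]
    · have := (f v).isLt
      rw [hrF v hv, Set.mem_Icc]
      omega
  · by_cases huI : u ∈ I
    · exact (hadj v (hc huv hu) u hu huv.symm fun hvI => hI.1 u huI v hvI huv).symm
    · exact hadj u hu v (hc huv hu) huv huI
  · by_cases huI : u ∈ I
    · rw [hrI u huI, hrF v fun hvI => hI.1 u huI v hvI huv]
      omega
    · exact absurd heq (hne u hu w (hc hvw (hc huv hu)) huI fun hwI =>
        mem_conflicts.2 ⟨hwI, huw.symm, v, huv, .inr hvw⟩)

theorem isKRanking_two_of_adj {r : V → ℤ} (h1 : ∀ u v, G.Adj u v → r u ≠ r v)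
    (h2 : ∀ u v w, G.Adj u v → G.Adj v w → u ≠ w → r u = r w → r u < r v) :
    G.IsKRanking 2 r := by
  rintro u v p hp h0 hle
  by_cases heq : r u = r v
  swap
  · exact .inl heq
  cases p with
  | nil => simp at h0
  | @cons _ w _ huw q =>
    cases q with
    | nil => exact absurd heq (h1 _ _ huw)
    | @cons _ x _ hwx q =>
      cases q with
      | nil =>
        have huv : u ≠ v := by
          rintro rfl
          simp at hp
        have hlt := h2 u w v huw hwx huv heq
        exact .inr ⟨w, by simp, huw.ne', hwx.ne, hlt, heq ▸ hlt⟩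
      | cons _ q =>
        simp only [Walk.length_cons] at hle
        omega

theorem IsSubcubic.exists_isKRanking_two [Fintype V] [DecidableRel G.Adj] (hG : G.IsSubcubic) :
    ∃ r : V → ℤ, G.IsKRanking 2 r ∧ ∀ v, r v ∈ Set.Icc (1 : ℤ) (7 : ℕ) := by
  choose r hr h1 h2 using fun c => exists_component_ranking hG c
  have hcomp : ∀ {u v}, G.Adj u v → G.connectedComponentMk u = G.connectedComponentMk v :=
    fun h => ConnectedComponent.sound h.reachable
  refine ⟨fun v => r (G.connectedComponentMk v) v, isKRanking_two_of_adj (fun u v huv => ?_)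
    (fun u v w huv hvw huw => ?_), fun v => by simpa using hr _ v⟩
  · simp only [← hcomp huv]
    exact h1 _ u rfl v huv
  · simp only [← hcomp hvw, ← hcomp huv]
    exact h2 _ u rfl v w huv hvw huw

end SimpleGraph

theorem mainTheorem7 {V : Type*} [Fintype V] (G : SimpleGraph V) [DecidableRel G.Adj]
    (hG : G.IsSubcubic) : G.kRankingNumber 2 ≤ 7 := by
  exact iInf₂_le 7 hG.exists_isKRanking_two
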